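/- Let $\mathbb H^{\mathbb C}$ be the algebra of complex quaternions $z_0+z_1I+z_2J+z_3K$ ($z_k\in\mathbb C$), and $H(z,z)=z_0^2+z_1^2+z_2^2+z_3^2$. Identify $SL_2(\mathbb C)$ with $\{z\in\mathbb H^{\mathbb C}: H(z,z)=1\}$ and $SU(2)$ with its subset of real points, so that $\mathbb H^3=SL_2(\mathbb C)/SU(2)$. On $\mathfrak g=\mathfrak{sl}_2(\mathbb C)=\mathbb CI\oplus\mathbb CJ\oplus\mathbb CK$ (with the commutator as bracket) let $B(z,z)=-4(z_1^2+z_2^2+z_3^2)$, and identify the Clifford algebra $Cl(\mathfrak g)$ of $(\mathfrak g,B)$, with the relations $u\cdot v+v\cdot u=-2B(u,v)$, with $\{\mathrm{diag}(a,b): a,b\in\mathbb H^{\mathbb C}\}$ through $z\mapsto 2\,\mathrm{diag}(-iz,iz)$; its even part is $\{\mathrm{diag}(a,a)\}\simeq\mathbb H^{\mathbb C}$. Let $e_1=\frac i2I,\ e_2=\frac i2J,\ e_3=\frac i2K$, and for $X\in\mathfrak g$ let $ad(X)=\frac12\sum_{k=1}^3e_k\cdot[X,e_k]\in Cl(\mathfrak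 g)$. Let $M$ be an oriented Riemannian surface with a spin structure, $E=M\times\mathbb R e_1$ the trivial oriented Euclidean line bundle with its trivial connection, and $II:TM\times TM\to E$ a symmetric bilinear map, with $H=\frac12\langle \mathrm{tr}\,II,e_1\rangle$. In a positively oriented orthonormal frame $(e_2,e_3)$ of $TM$, the bundle $TM\oplus E$ is framed by $(e_1,e_2,e_3)$, identified with the above vectors of $\mathfrak g$. Let $\Sigma$ be the bundle associated with the spin structure and with the action of $Spin(2)=\{\cos\theta+\sin\theta\,e_2\cdot e_3\}$ on $Cl(\mathfrak g)$ by left multiplication, let $U\Sigma\subset\Sigma$ be the sub-bundle with fibre $\{\mathrm{diag}(a,a): H(a,a)=1\}$, and let $\nabla$ be the connection on $\Sigma$ induced by the Levi-Civita connection of $M$. Let $\varphi$ be a smooth section of $U\Sigma$ which solves the Killing-type equation $$\nabla_X\varphi=-\tfrac12\,II(X)\cdot\varphi-\tfrac12\,ad(X)\cdot\varphi,\qquad X\in TM,$$ where $II(X)=\sum_{j=2}^3e_j\cdot II(X,e_j)$. Let $\varphi^+$ be the component of $\varphi$ in the first summand of $\mathbb H^{\mathbb C}=\mathbb H^{\mathbb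 C}(1-iI)\oplus\mathbb H^{\mathbb C}(1+iI)$. Let $\Sigma M$ be the usual complex spinor bundle of $M$, of rank 2, with its spinorial connection, its Hermitian product $\langle\cdot,\cdot\rangle$ and its Clifford multiplication (for which unit tangent vectors act by skew-Hermitian maps of square $-1$), and let $\psi\mapsto\psi^*$, $(z_1,z_2)\mapsto(z_1+iz_2J)(1-iI)$ in a spin frame, be its identification with the sub-bundle of $\Sigma$ of fibre $\mathbb H^{\mathbb C}(1-iI)$; it satisfies $(X\cdot\psi)^*=X\cdot e_1\cdot\psi^*$ for $X\in TM$. Set $\overline\psi=i\,e_2\cdot e_3\cdot\psi$ (that is, $\overline\psi=\psi^+-\psi^-$ for the splitting of $\psi$ into half-spinors, the eigenvectors of $i\,e_2\cdot e_3$ for the eigenvalues $1$ and $-1$) and $D\psi=e_2\cdot\nabla_{e_2}\psi+e_3\cdot\nabla_{e_3}\psi$. Then there is a smooth section $\psi$ of $\Sigma M$ with $\psi^*=\varphi^+$, and it satisfies the Dirac equation $$D\psi=H\psi-\overline\psi$$ and the normalization $$\partial_X|\psi|^2=\mathrm{Re}\,\langle X\cdot\overline\psi,\psi\rangle\qquad\text{for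 all }X\in TM.$$ Moreover $\psi$ never vanishes. -/

import Mathlib

open scoped Manifold ContDiff Bundle Quaternion

noncomputable section

namespace MorelH3

/-! ## Complex quaternions and the Clifford algebra of `𝔤 = 𝔰𝔩₂(ℂ)` -/

/-- The complex quaternions `ℍ^ℂ = {z₀ + z₁ I + z₂ J + z₃ K : z_k ∈ ℂ}`. -/
abbrev HC : Type := Quaternion ℂ

/-- The four complex coordinates of a complex quaternion. -/
def HC.coords : HC →ₗ[ℝ] (Fin 4 → ℂ) where
  toFun z := ![z.re, z.imI, z.imJ, z.imK]
  map_add' z w := by ext k; fin_cases k <;> simp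
  map_smul' r z := by ext k; fin_cases k <;> simp

theorem HC.coords_injective : Function.Injective HC.coords := by
  intro z w h
  have h0 := congrFun h 0
  have h1 := congrFun h 1
  have h2 := congrFun h 2
  have h3 := congrFun h 3
  simp [HC.coords] at h0 h1 h2 h3
  exact QuaternionAlgebra.ext h0 h1 h2 h3

/-- `ℍ^ℂ ≅ ℂ⁴` as a real normed space; it is used only to differentiate
`ℍ^ℂ`-valued functions, coordinate by coordinate. -/
instance : NormedAddCommGroup HC :=
  NormedAddCommGroup.induced HC (Fin 4 → ℂ) HC.coords HC.coords_injective

instance : NormedSpace ℝ HC := NormedSpace.induced ℝ HC (Fin 4 → ℂ) HC.coords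

/-- The quaternion units. -/
def qI : HC := ⟨0, 1, 0, 0⟩
def qJ : HC := ⟨0, 0, 1, 0⟩
def qK : HC := ⟨0, 0, 0, 1⟩

@[simp] theorem qI_re : qI.re = 0 := rfl
@[simp] theorem qI_imI : qI.imI = 1 := rfl
@[simp] theorem qI_imJ : qI.imJ = 0 := rfl
@[simp] theorem qI_imK : qI.imK = 0 := rfl
@[simp] theorem qJ_re : qJ.re = 0 := rfl
@[simp] theorem qJ_imI : qJ.imI = 0 := rfl
@[simp] theorem qJ_imJ : qJ.imJ = 1 := rfl
@[simp] theorem qJ_imK : qJ.imK = 0 := rfl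
@[simp] theorem qK_re : qK.re = 0 := rfl
@[simp] theorem qK_imI : qK.imI = 0 := rfl
@[simp] theorem qK_imJ : qK.imJ = 0 := rfl
@[simp] theorem qK_imK : qK.imK = 1 := rfl

/-- The complex bilinear form `H` on `ℍ^ℂ` with `H(z,z) = z₀² + z₁² + z₂² + z₃²`. -/
def formH (z w : HC) : ℂ := z.re * w.re + z.imI * w.imI + z.imJ * w.imJ + z.imK * w.imK

/-- `G = SL₂(ℂ)`, as the complex 3-sphere `{z ∈ ℍ^ℂ : H(z,z) = 1}`
(and `SU(2)` is the set of its real points). -/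
def complexSphere : Set HC := {z | formH z z = 1}

/-- The form `B(z,w) = -4 (z₁w₁ + z₂w₂ + z₃w₃)`, half of the Killing form, on
`𝔤 = ℂ I ⊕ ℂ J ⊕ ℂ K`; the Lie bracket of `𝔤` is the commutator of `ℍ^ℂ`. -/
def formB (z w : HC) : ℂ := -4 * (z.imI * w.imI + z.imJ * w.imJ + z.imK * w.imK)

/-- `Cl(𝔤)`, the Clifford algebra of `(𝔤, B)` (with `u · u = -B(u,u)`), as the algebra of the
diagonal matrices `diag(a, b)` with `a, b ∈ ℍ^ℂ`. -/
abbrev Cl : Type := HC × HC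

/-- The inclusion `𝔤 → Cl(𝔤)`, `z ↦ 2 diag(-i z, i z)`. -/
def vec (z : HC) : Cl := ((-2 * Complex.I) • z, (2 * Complex.I) • z)

/-- The orthonormal basis `e₁ = (i/2) I`, `e₂ = (i/2) J`, `e₃ = (i/2) K` of `𝔪 = i 𝔰𝔲(2) = T_o ℍ³`;
here `e₁` is the unit normal and `e₂, e₃` are tangent to the surface. -/
def e₁ : HC := (Complex.I / 2) • qI
def e₂ : HC := (Complex.I / 2) • qJ
def e₃ : HC := (Complex.I / 2) • qK

/-- The element `ad(X) = ½ ∑ₖ eₖ · [X, eₖ]` of `Λ²𝔤 ⊂ Cl(𝔤)` which represents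
the endomorphism `[X, ·]` of `𝔤`. -/
def adCl (X : HC) : Cl :=
  (1 / 2 : ℂ) • (vec e₁ * vec ⁅X, e₁⁆ + vec e₂ * vec ⁅X, e₂⁆ + vec e₃ * vec ⁅X, e₃⁆)

/-- The morphism `G → Spin(𝔤) ⊂ Cl(𝔤)` which lifts the adjoint representation. -/
def adTilde (a : HC) : Cl := (a, a)

/-- The group `Ãd(G) ⊂ Spin(𝔤)`, the typical fibre of the bundle `UΣ` of unit spinors. -/
def adTildeG : Set Cl := adTilde '' complexSphere

/-- The component in the left ideal `Cl⁰(𝔤)(1 - iI)` for the splitting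
`ℍ^ℂ = ℍ^ℂ(1 - iI) ⊕ ℍ^ℂ(1 + iI)` of `Cl⁰(𝔤) ≅ ℍ^ℂ`. -/
def plusPart (a : Cl) : Cl := a * adTilde ((1 / 2 : ℂ) • (1 - Complex.I • qI))

/-- The group `Spin(2) = {cos θ + sin θ e₂ · e₃}`, parametrized by the unit circle, acts on `Cl(𝔤)`
by multiplication on the left. The double covering `Spin(2) → SO(2)` is `u ↦ u²`. -/
def rhoCl (u : Circle) (a : Cl) : Cl :=
  ((u : ℂ).re • (1 : Cl) + (u : ℂ).im • (vec e₂ * vec e₃)) * a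

/-! ## The usual spinor space in dimension 2 -/

/-- The complex spinor space `ℂ²` of `Cl(2)`, with its standard Hermitian product. -/
abbrev Spinor : Type := EuclideanSpace ℂ (Fin 2)

/-- Clifford multiplication by `e₂`. -/
def cl₂ : Spinor →ₗ[ℂ] Spinor := Matrix.toEuclideanLin !![0, -1; 1, 0]

/-- Clifford multiplication by `e₃`. -/
def cl₃ : Spinor →ₗ[ℂ] Spinor := Matrix.toEuclideanLin !![0, -Complex.I; -Complex.I, 0]

/-- The spinor representation of `Spin(2)`. -/
def rhoSpinor (u : Circle) (z : Spinor) : Spinor := (u : ℂ).re • z + (u : ℂ).im • cl₂ (cl₃ z)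

/-- The conjugate `ψ̄ = ψ⁺ - ψ⁻`, where `ψ = ψ⁺ + ψ⁻` is the splitting into half-spinors, i.e. into
eigenvectors of `i e₂ · e₃` for the eigenvalues `1` and `-1`; that is, `ψ̄ = i e₂ · e₃ · ψ`. -/
def bar (z : Spinor) : Spinor := Complex.I • cl₂ (cl₃ z)

/-- The identification `ψ ↦ ψ*` of the spinor space with `ℍ^ℂ(1 - iI) ⊂ Cl⁰(𝔤)`,
`(z₁, z₂) ↦ (z₁ + i z₂ J)(1 - iI)`. -/
def starMap (z : Spinor) : Cl :=
  adTilde ((z 0 • (1 : HC) + (Complex.I * z 1) • qJ) * (1 - Complex.I • qI))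

/-! ### Consistency of these models -/

theorem vec_e₁ : vec e₁ = (qI, -qI) := by
  have h : 2 * Complex.I * (Complex.I / 2) = -1 := by linear_combination Complex.I_mul_I
  simp [vec, e₁, smul_smul, h]

theorem vec_e₂ : vec e₂ = (qJ, -qJ) := by
  have h : 2 * Complex.I * (Complex.I / 2) = -1 := by linear_combination Complex.I_mul_I
  simp [vec, e₂, smul_smul, h]

theorem vec_e₃ : vec e₃ = (qK, -qK) := by
  have h : 2 * Complex.I * (Complex.I / 2) = -1 := by linear_combination Complex.I_mul_I
  simp [vec, e₃, smul_smul, h]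

/-- The Clifford relations `u · v + v · u = -2 B(u,v)` hold for `u, v ∈ 𝔤`. -/
theorem vec_mul_vec (z w : HC) (hz : z.re = 0) (hw : w.re = 0) :
    vec z * vec w + vec w * vec z = (-2 * formB z w) • (1 : Cl) := by
  have key : ∀ c : ℂ, c * c = -4 → (c • z) * (c • w) + (c • w) * (c • z)
      = (-2 * formB z w) • (1 : HC) := by
    intro c hc
    ext <;> simp [formB, hz, hw]
    · linear_combination (-2 * (z.imI * w.imI + z.imJ * w.imJ + z.imK * w.imK)) * hc
    all_goals ring
  refine Prod.ext ?_ ?_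
  · exact key _ (by linear_combination 4 * Complex.I_mul_I)
  · exact key _ (by linear_combination 4 * Complex.I_mul_I)

/-- `Ãd(a)` lifts `Ad(a) : z ↦ a z a⁻¹`. -/
theorem adTilde_conj (a z : HC) :
    adTilde a * vec z * adTilde (star a) = vec (a * z * star a) := by
  refine Prod.ext ?_ ?_ <;> ext <;> simp [adTilde, vec] <;> ring

/-- `u ∈ Spin(2)` acts on the tangent vectors as the rotation `u²`. -/
theorem rhoCl_vec_e₂ (u : Circle) :
    rhoCl u (vec e₂) = (((u : ℂ) ^ 2).re • vec e₂ + ((u : ℂ) ^ 2).im • vec e₃) * rhoCl u 1 := by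
  have hu : (u : ℂ).re * (u : ℂ).re + (u : ℂ).im * (u : ℂ).im = 1 := by
    have := Circle.normSq_coe u
    rwa [Complex.normSq_apply] at this
  rw [rhoCl, rhoCl, vec_e₂, vec_e₃]
  generalize (u : ℂ) = v at *
  obtain ⟨c, s⟩ := v
  have hC : (c : ℂ) * c + s * s = 1 := by exact_mod_cast hu
  simp only at hu
  refine Prod.ext ?_ ?_ <;> ext <;> simp [pow_two] <;>
    first | linear_combination (c : ℂ) * hC | linear_combination (-(c : ℂ)) * hC
          | linear_combination (s : ℂ) * hC | linear_combination (-(s : ℂ)) * hC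

theorem cl₂_apply (z : Spinor) : cl₂ z = !₂[-z 1, z 0] := by
  ext k; fin_cases k <;> simp [cl₂, Matrix.toLpLin_apply, dotProduct]

theorem cl₃_apply (z : Spinor) : cl₃ z = !₂[-(Complex.I * z 1), -(Complex.I * z 0)] := by
  ext k; fin_cases k <;> simp [cl₃, Matrix.toLpLin_apply, dotProduct]

/-- `(X · ψ)* = X · e₁ · ψ*` for `X = e₂`. -/
theorem starMap_cl₂ (z : Spinor) : starMap (cl₂ z) = vec e₂ * vec e₁ * starMap z := by
  have h := Complex.I_mul_I
  rw [cl₂_apply, vec_e₁, vec_e₂]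
  refine Prod.ext ?_ ?_ <;> ext <;> simp [starMap, adTilde] <;>
    first | ring1 | linear_combination (z 1) * h | linear_combination (-(z 1)) * h
          | linear_combination (z 0) * h

/-- `(X · ψ)* = X · e₁ · ψ*` for `X = e₃`. -/
theorem starMap_cl₃ (z : Spinor) : starMap (cl₃ z) = vec e₃ * vec e₁ * starMap z := by
  have h := Complex.I_mul_I
  rw [cl₃_apply, vec_e₁, vec_e₃]
  refine Prod.ext ?_ ?_ <;> ext <;> simp [starMap, adTilde] <;>
    first | ring1 | linear_combination (z 0) * h | linear_combination (-(z 0)) * h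
          | linear_combination (Complex.I * z 0) * h | linear_combination (-(Complex.I * z 0)) * h

/-! ## Spin structures on a surface, spinor fields and spinorial connections -/

/-- The model of the surface. -/
abbrev E2 : Type := EuclideanSpace ℝ (Fin 2)

section Surface

open Bundle

variable (M : Type*) [TopologicalSpace M] [ChartedSpace E2 M] [IsManifold (𝓡 2) ∞ M]
  [RiemannianBundle (fun x : M ↦ TangentSpace (𝓡 2) x)]

/-- An orientation and a spin structure on a Riemannian surface `M`, given by local trivializations
of the `Spin(2)`-principal bundle: an open cover `(Uᵢ)`, over each `Uᵢ` a spin frame lying above a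
smooth orthonormal frame `(e₂, e₃)` of `TM`, and a cocycle `gᵢⱼ : Uᵢ ∩ Uⱼ → Spin(2) = U(1)`
(the `j`-th spin frame is the `i`-th one acted on by `gᵢⱼ`) which lifts the transition functions
`gᵢⱼ² ∈ SO(2)` of the frames. -/
structure SpinStructure (ι : Type*) where
  U : ι → Set M
  isOpen_U : ∀ i, IsOpen (U i)
  cover : ∀ x, ∃ i, x ∈ U i
  frame₂ : ι → Π x : M, TangentSpace (𝓡 2) x
  frame₃ : ι → Π x : M, TangentSpace (𝓡 2) x
  smooth₂ : ∀ i, ContMDiffOn (𝓡 2) ((𝓡 2).prod 𝓘(ℝ, E2)) ∞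
    (fun x ↦ TotalSpace.mk' E2 x (frame₂ i x)) (U i)
  smooth₃ : ∀ i, ContMDiffOn (𝓡 2) ((𝓡 2).prod 𝓘(ℝ, E2)) ∞
    (fun x ↦ TotalSpace.mk' E2 x (frame₃ i x)) (U i)
  orthonormal : ∀ i, ∀ x ∈ U i, ‖frame₂ i x‖ = 1 ∧ ‖frame₃ i x‖ = 1 ∧
    inner ℝ (frame₂ i x) (frame₃ i x) = 0
  g : ι → ι → M → Circle
  smooth_g : ∀ i j, ContMDiffOn (𝓡 2) 𝓘(ℝ, ℂ) ∞ (fun x ↦ (g i j x : ℂ)) (U i ∩ U j)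
  cocycle : ∀ i j k, ∀ x ∈ U i ∩ U j ∩ U k, g i j x * g j k x = g i k x
  lift₂ : ∀ i j, ∀ x ∈ U i ∩ U j, frame₂ j x =
    ((g i j x : ℂ) ^ 2).re • frame₂ i x + ((g i j x : ℂ) ^ 2).im • frame₃ i x
  lift₃ : ∀ i j, ∀ x ∈ U i ∩ U j, frame₃ j x =
    -((g i j x : ℂ) ^ 2).im • frame₂ i x + ((g i j x : ℂ) ^ 2).re • frame₃ i x

variable {M} {ι : Type*}

/-- A smooth section `φ` of the vector bundle with fibre `F` associated with the spin structure `S`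
and with the representation `ρ` of `Spin(2)`: its components `[φ]ᵢ : Uᵢ → F` in the spin frames,
which are related by `[φ]ᵢ = ρ(gᵢⱼ) [φ]ⱼ`. -/
structure SpinStructure.Section (S : SpinStructure M ι) (F : Type*) [NormedAddCommGroup F]
    [NormedSpace ℝ F] (ρ : Circle → F → F) where
  comp : ι → M → F
  smooth : ∀ i, ContMDiffOn (𝓡 2) 𝓘(ℝ, F) ∞ (comp i) (S.U i)
  compat : ∀ i j, ∀ x ∈ S.U i ∩ S.U j, comp i x = ρ (S.g i j x) (comp j x)

namespace SpinStructure

variable (S : SpinStructure M ι)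

/-- Smooth sections of the bundle `Σ` with fibre `Cl(𝔤)` (`TM ⊕ E` is framed by `(e₁, e₂, e₃)`, where
`e₁` is the unit section of the trivial line bundle `E`, so the structure group is `Spin(2)`). -/
abbrev SigmaSection : Type _ := S.Section Cl rhoCl

/-- Smooth sections of the usual spinor bundle `ΣM`. -/
abbrev SpinorField : Type _ := S.Section Spinor rhoSpinor

variable {S}

/-- `φ` is a section of the bundle `UΣ` of unit spinors. -/
def IsUnitSection (φ : S.SigmaSection) : Prop := ∀ i, ∀ x ∈ S.U i, φ.comp i x ∈ adTildeG

variable (S)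

/-- `nabla` is the Levi-Civita connection of `M`. -/
def _root_.MorelH3.IsLeviCivita [h : IsContMDiffRiemannianBundle (𝓡 2) ∞ E2
      (fun x : M ↦ TangentSpace (𝓡 2) x)]
    (nabla : CovariantDerivative (𝓡 2) E2 (fun x : M ↦ TangentSpace (𝓡 2) x)) : Prop :=
  haveI : IsContMDiffRiemannianBundle (𝓡 2) 1 E2 (fun x : M ↦ TangentSpace (𝓡 2) x) :=
    h.of_le (by exact_mod_cast le_top)
  nabla.IsMetricCompatible ∧ nabla.torsion = 0

variable (nabla : CovariantDerivative (𝓡 2) E2 (fun x : M ↦ TangentSpace (𝓡 2) x))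

/-- The connection form `⟨∇_X e₂, e₃⟩` in the `i`-th frame. -/
def connForm (i : ι) (x : M) (X : TangentSpace (𝓡 2) x) : ℝ :=
  inner ℝ (nabla (S.frame₂ i) x X) (S.frame₃ i x)

/-- The spinorial connection of `Σ` induced by the Levi-Civita connection of `TM` and the trivial
connection of `E = ℝ e₁`: the component of `∇_X φ` in the `i`-th spin frame. -/
def covSigma (φ : S.SigmaSection) (i : ι) (x : M) (X : TangentSpace (𝓡 2) x) : Cl :=
  mvfderiv (𝓡 2) (φ.comp i) x X +
    (1 / 2 * S.connForm nabla i x X) • (vec e₂ * vec e₃ * φ.comp i x)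

/-- The spinorial connection of `ΣM`: the component of `∇_X ψ` in the `i`-th spin frame. -/
def covSpinor (ψ : S.SpinorField) (i : ι) (x : M) (X : TangentSpace (𝓡 2) x) : Spinor :=
  mvfderiv (𝓡 2) (ψ.comp i) x X +
    (1 / 2 * S.connForm nabla i x X) • cl₂ (cl₃ (ψ.comp i x))

/-- The vector of `𝔪` which represents the tangent vector `X` in the `i`-th frame. -/
def tangentVec (i : ι) (x : M) (X : TangentSpace (𝓡 2) x) : HC :=
  (inner ℝ X (S.frame₂ i x)) • e₂ + (inner ℝ X (S.frame₃ i x)) • e₃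

/-- Clifford multiplication by the tangent vector `X` on `ΣM`, in the `i`-th frame. -/
def clifford (i : ι) (x : M) (X : TangentSpace (𝓡 2) x) (z : Spinor) : Spinor :=
  (inner ℝ X (S.frame₂ i x)) • cl₂ z + (inner ℝ X (S.frame₃ i x)) • cl₃ z

variable (II : Π x : M, TangentSpace (𝓡 2) x →ₗ[ℝ] TangentSpace (𝓡 2) x →ₗ[ℝ] ℝ)

/-- The element `II(X) = ∑ⱼ eⱼ · II(X, eⱼ)` (`j = 2, 3`) of `Cl(𝔤)`, in the `i`-th frame, where
`II(X,Y) e₁` is the `E`-valued bilinear map. -/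
def clII (i : ι) (x : M) (X : TangentSpace (𝓡 2) x) : Cl :=
  vec e₂ * (II x X (S.frame₂ i x) • vec e₁) + vec e₃ * (II x X (S.frame₃ i x) • vec e₁)

/-- The mean curvature `H = ½ tr II`, computed in the `i`-th frame. -/
def meanCurvature (i : ι) (x : M) : ℝ :=
  1 / 2 * (II x (S.frame₂ i x) (S.frame₂ i x) + II x (S.frame₃ i x) (S.frame₃ i x))

/-- The Killing-type equation `∇_X φ = -½ II(X) · φ - ½ ad(X) · φ`. -/
def IsKilling (φ : S.SigmaSection) : Prop :=
  ∀ i, ∀ x ∈ S.U i, ∀ X : TangentSpace (𝓡 2) x,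
    S.covSigma nabla φ i x X = -(1 / 2 : ℝ) • (S.clII II i x X * φ.comp i x)
      - (1 / 2 : ℝ) • (adCl (S.tangentVec i x X) * φ.comp i x)

/-- The Dirac operator `D ψ = e₂ · ∇_{e₂} ψ + e₃ · ∇_{e₃} ψ` of `M`, in the `i`-th spin frame. -/
def dirac (ψ : S.SpinorField) (i : ι) (x : M) : Spinor :=
  S.clifford i x (S.frame₂ i x) (S.covSpinor nabla ψ i x (S.frame₂ i x)) +
    S.clifford i x (S.frame₃ i x) (S.covSpinor nabla ψ i x (S.frame₃ i x))

variable {S}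

/-- `ψ ∈ Γ(ΣM)` corresponds to `φ⁺`: `ψ* = φ⁺`. -/
def CorrespondsToPlus (ψ : S.SpinorField) (φ : S.SigmaSection) : Prop :=
  ∀ i, ∀ x ∈ S.U i, starMap (ψ.comp i x) = plusPart (φ.comp i x)

end SpinStructure

end Surface

end MorelH3

end

noncomputable section

namespace MorelH3

/-! The passage from `φ` to `ψ` is the fixed complex-linear map `spinorOf`, applied pointwise. The
projection to `ℍ^ℂ(1 - iI)` is a right multiplication, so it commutes with left Clifford
multiplication. Hence `spinorOf` turns `e₂·e₁`, `e₃·e₁`, `e₂·e₃` into `cl₂`, `cl₃`, `cl₂ ∘ cl₃`, and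
it respects `Spin(2)` and the connections.

Since `[e₂, e₃] = i e₁` and cyclically, `ad(X)` is `i` times a combination of `e₂·e₁` and `e₃·e₁`,
and it acts on `ψ` as `-X·ψ̄`. With `A(X) = ∑ⱼ II(X, eⱼ) eⱼ`, the Killing-type equation becomes `∇_X
ψ = -½ A(X)·ψ + ½ X·ψ̄` (`IsKilling.covSpinor_eq`). Tracing it gives the Dirac equation. Pairing it
with `ψ` gives the normalization, as Clifford multiplication by real vectors is skew-Hermitian.
Nonvanishing comes from `H(a,a) = 1`. -/

/-- The `ℂ`-linear map `a ↦ ψ` determined by `ψ* = a⁺` for `a` in the even part of `Cl(𝔤)`. -/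
def spinorOf : Cl →ₗ[ℂ] Spinor where
  -- These are the coordinates of `½ a (1 - iI)` along `1` and, after division by `i`, along `J`.
  -- Only the first diagonal entry is read, so the map is defined on all of `Cl`.
  toFun a := !₂[(a.1.re + Complex.I * a.1.imI) / 2, -((Complex.I * a.1.imJ + a.1.imK) / 2)]
  map_add' a b := by ext k; fin_cases k <;> simp <;> ring
  map_smul' c a := by ext k; fin_cases k <;> simp <;> ring

theorem spinorOf_apply_zero (a : Cl) : spinorOf a 0 = (a.1.re + Complex.I * a.1.imI) / 2 := rfl

theorem spinorOf_apply_one (a : Cl) : spinorOf a 1 = -((Complex.I * a.1.imJ + a.1.imK) / 2) := rfl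

theorem starMap_spinorOf (a : HC) : starMap (spinorOf (adTilde a)) = plusPart (adTilde a) := by
  have h := Complex.I_mul_I
  refine Prod.ext ?_ ?_ <;> ext <;>
    simp [starMap, plusPart, adTilde, spinorOf_apply_zero, spinorOf_apply_one] <;> grind

/-- The coordinates of `z*` along `1` and `J` are `z₁` and `i z₂`, so `ψ` is determined by `φ⁺`; one
diagonal entry suffices, and `a` need not be even. -/
theorem eq_spinorOf_of_starMap_eq {z : Spinor} {a : Cl} (hz : starMap z = plusPart a) :
    z = spinorOf a := by
  have h := Complex.I_mul_I
  have h0 := congrArg (fun b : Cl ↦ b.1.re) hz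
  have h1 := congrArg (fun b : Cl ↦ b.1.imJ) hz
  simp [starMap, plusPart, adTilde] at h0 h1
  ext k
  fin_cases k
  · simp [spinorOf_apply_zero]; grind
  · simp [spinorOf_apply_one]; grind

/-! ### Compatibility with Clifford multiplication -/

theorem spinorOf_e₂_mul_e₁ (a : Cl) : spinorOf (vec e₂ * vec e₁ * a) = cl₂ (spinorOf a) := by
  have h := Complex.I_mul_I
  ext k
  fin_cases k <;> simp [cl₂_apply, spinorOf, vec_e₁, vec_e₂] <;> grind

theorem spinorOf_e₃_mul_e₁ (a : Cl) : spinorOf (vec e₃ * vec e₁ * a) = cl₃ (spinorOf a) := by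
  have h := Complex.I_mul_I
  ext k
  fin_cases k <;> simp [cl₃_apply, spinorOf, vec_e₁, vec_e₃] <;> grind

/-- Consistent with the two previous rules, as `e₂·e₃ = (e₂·e₁)·(e₃·e₁)`. -/
theorem spinorOf_e₂_mul_e₃ (a : Cl) :
    spinorOf (vec e₂ * vec e₃ * a) = cl₂ (cl₃ (spinorOf a)) := by
  have h := Complex.I_mul_I
  ext k
  fin_cases k <;> simp [cl₂_apply, cl₃_apply, spinorOf, vec_e₂, vec_e₃] <;> grind

instance : IsScalarTower ℂ Cl Cl :=
  ⟨fun c a b ↦ by refine Prod.ext ?_ ?_ <;> ext <;> simp <;> ring⟩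

instance : IsScalarTower ℝ Cl Cl :=
  ⟨fun c a b ↦ by refine Prod.ext ?_ ?_ <;> ext <;> simp <;> ring⟩

instance : SMulCommClass ℝ Cl Cl :=
  ⟨fun c a b ↦ by refine Prod.ext ?_ ?_ <;> ext <;> simp <;> ring⟩

theorem spinorOf_rhoCl (u : Circle) (a : Cl) :
    spinorOf (rhoCl u a) = rhoSpinor u (spinorOf a) := by
  rw [rhoCl, add_mul, smul_mul_assoc, smul_mul_assoc, one_mul, map_add,
    LinearMap.map_smul_of_tower, LinearMap.map_smul_of_tower, spinorOf_e₂_mul_e₃, rhoSpinor]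

/-- From `[e₂, e₃] = i e₁` and its cyclic versions, `ad(e₂) = i e₃·e₁` and `ad(e₃) = -i e₂·e₁`. -/
theorem adCl_tangent (s t : ℝ) : adCl (s • e₂ + t • e₃)
    = Complex.I • (s • (vec e₃ * vec e₁) - t • (vec e₂ * vec e₁)) := by
  have h := Complex.I_mul_I
  rw [adCl, vec_e₁, vec_e₂, vec_e₃]
  refine Prod.ext ?_ ?_ <;> ext <;> simp [vec, e₁, e₂, e₃, Bracket.bracket] <;> grind

theorem spinorOf_adCl_mul (s t : ℝ) (a : Cl) : spinorOf (adCl (s • e₂ + t • e₃) * a)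
    = Complex.I • (s • cl₃ (spinorOf a) - t • cl₂ (spinorOf a)) := by
  rw [adCl_tangent, smul_mul_assoc, sub_mul, smul_mul_assoc, smul_mul_assoc, map_smul, map_sub,
    LinearMap.map_smul_of_tower, LinearMap.map_smul_of_tower, spinorOf_e₂_mul_e₁,
    spinorOf_e₃_mul_e₁]

/-- `H(b,b) = (b₀ + i b₁)(b₀ - i b₁) + (b₂ + i b₃)(b₂ - i b₃)`, and the components of the spinor are
multiples of `b₀ + i b₁` and `b₂ - i b₃`; if both vanished, `H(b,b)` would be `0`. -/
theorem spinorOf_ne_zero {a : Cl} (ha : a ∈ adTildeG) : spinorOf a ≠ 0 := by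
  obtain ⟨b, hb, rfl⟩ := ha
  intro h0
  have h := Complex.I_mul_I
  have h1 := congrFun (congrArg WithLp.ofLp h0) 0
  have h2 := congrFun (congrArg WithLp.ofLp h0) 1
  simp only [spinorOf_apply_zero, spinorOf_apply_one, adTilde, PiLp.zero_apply] at h1 h2
  simp only [complexSphere, formH, Set.mem_ofPred_eq] at hb
  grind

instance : FiniteDimensional ℝ HC :=
  FiniteDimensional.of_injective HC.coords HC.coords_injective

/-- `spinorOf` as a continuous real linear map. -/
def spinorOfL : Cl →L[ℝ] Spinor := LinearMap.toContinuousLinearMap (spinorOf.restrictScalars ℝ)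

theorem spinorOfL_apply (a : Cl) : spinorOfL a = spinorOf a := rfl

/-! ### Transfer of sections and derivatives -/

section Surface

variable {M : Type*} [TopologicalSpace M] [ChartedSpace E2 M]

theorem mvfderiv_comp_apply_of_hasFDerivAt {F G : Type*} [NormedAddCommGroup F] [NormedSpace ℝ F]
    [NormedAddCommGroup G] [NormedSpace ℝ G] {f : F → G} {f' : F →L[ℝ] G} {u : M → F} {x : M}
    (hf : HasFDerivAt f f' (u x)) (hu : MDifferentiableAt (𝓡 2) 𝓘(ℝ, F) u x)
    (X : TangentSpace (𝓡 2) x) :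
    mvfderiv (𝓡 2) (fun y ↦ f (u y)) x X = f' (mvfderiv (𝓡 2) u x X) := by
  have h := (hf.hasMFDerivAt.comp x hu.hasMFDerivAt).mfderiv
  change mfderiv (𝓡 2) 𝓘(ℝ, G) (f ∘ u) x X = _
  rw [h]
  rfl

variable [IsManifold (𝓡 2) ∞ M] [Bundle.RiemannianBundle (fun x : M ↦ TangentSpace (𝓡 2) x)]
  {ι : Type*} {S : SpinStructure M ι}

namespace SpinStructure

theorem Section.mdifferentiableAt {F : Type*} [NormedAddCommGroup F] [NormedSpace ℝ F]
    {ρ : Circle → F → F} (φ : S.Section F ρ) {i : ι} {x : M} (hx : x ∈ S.U i) :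
    MDifferentiableAt (𝓡 2) 𝓘(ℝ, F) (φ.comp i) x :=
  ((φ.smooth i).contMDiffAt ((S.isOpen_U i).mem_nhds hx)).mdifferentiableAt (by simp)

/-- The spinor field `ψ` with `ψ* = φ⁺`. -/
def plusSpinor (φ : S.SigmaSection) : S.SpinorField where
  comp i x := spinorOfL (φ.comp i x)
  smooth i := spinorOfL.contMDiff.comp_contMDiffOn (φ.smooth i)
  compat i j x hx := by
    simp only [spinorOfL_apply, φ.compat i j x hx, spinorOf_rhoCl]

theorem correspondsToPlus_plusSpinor {φ : S.SigmaSection} (hφ : IsUnitSection φ) :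
    CorrespondsToPlus (plusSpinor φ) φ := by
  intro i x hx
  obtain ⟨a, -, ha⟩ := hφ i x hx
  change starMap (spinorOf (φ.comp i x)) = _
  rw [← ha, starMap_spinorOf]

variable (nabla : CovariantDerivative (𝓡 2) E2 (fun x : M ↦ TangentSpace (𝓡 2) x))
  {II : Π x : M, TangentSpace (𝓡 2) x →ₗ[ℝ] TangentSpace (𝓡 2) x →ₗ[ℝ] ℝ}
  {φ : S.SigmaSection} {ψ : S.SpinorField}

theorem CorrespondsToPlus.comp_eq (h : CorrespondsToPlus ψ φ) {i : ι} {x : M} (hx : x ∈ S.U i) :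
    ψ.comp i x = spinorOf (φ.comp i x) :=
  eq_spinorOf_of_starMap_eq (h i x hx)

theorem CorrespondsToPlus.mvfderiv_eq (h : CorrespondsToPlus ψ φ) {i : ι} {x : M}
    (hx : x ∈ S.U i) (X : TangentSpace (𝓡 2) x) :
    mvfderiv (𝓡 2) (ψ.comp i) x X = spinorOf (mvfderiv (𝓡 2) (φ.comp i) x X) := by
  -- The two functions agree only on the open set `S.U i`, which is enough for the derivatives at
  -- `x`.
  have heq : ψ.comp i =ᶠ[nhds x] fun y ↦ spinorOfL (φ.comp i y) :=
    Filter.eventually_of_mem ((S.isOpen_U i).mem_nhds hx) fun y hy ↦ h.comp_eq hy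
  have key := mvfderiv_comp_apply_of_hasFDerivAt spinorOfL.hasFDerivAt (φ.mdifferentiableAt hx) X
  rw [spinorOfL_apply] at key
  rw [← key]
  change mfderiv (𝓡 2) 𝓘(ℝ, Spinor) (ψ.comp i) x X = _
  rw [heq.mfderiv_eq (I := 𝓡 2) (I' := 𝓘(ℝ, Spinor))]
  rfl

/-- Both connections are `d + ½ ω e₂·e₃` with the same form `ω`, and `spinorOf` is constant and
linear. -/
theorem CorrespondsToPlus.covSpinor_eq (h : CorrespondsToPlus ψ φ) {i : ι} {x : M}
    (hx : x ∈ S.U i) (X : TangentSpace (𝓡 2) x) :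
    S.covSpinor nabla ψ i x X = spinorOf (S.covSigma nabla φ i x X) := by
  rw [covSpinor, covSigma, h.mvfderiv_eq hx, h.comp_eq hx, map_add,
    LinearMap.map_smul_of_tower, spinorOf_e₂_mul_e₃]

theorem spinorOf_clII_mul (i : ι) (x : M) (X : TangentSpace (𝓡 2) x) (a : Cl) :
    spinorOf (S.clII II i x X * a) = II x X (S.frame₂ i x) • cl₂ (spinorOf a)
      + II x X (S.frame₃ i x) • cl₃ (spinorOf a) := by
  rw [clII, add_mul, mul_smul_comm, mul_smul_comm, smul_mul_assoc, smul_mul_assoc, map_add,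
    LinearMap.map_smul_of_tower, LinearMap.map_smul_of_tower, spinorOf_e₂_mul_e₁,
    spinorOf_e₃_mul_e₁]

/-! ### The equation for `ψ` and its consequences -/

variable {nabla}

theorem IsKilling.covSpinor_eq (hφ : S.IsKilling nabla II φ) (h : CorrespondsToPlus ψ φ) {i : ι}
    {x : M} (hx : x ∈ S.U i) (X : TangentSpace (𝓡 2) x) :
    S.covSpinor nabla ψ i x X =
      -(1 / 2 : ℝ) • (II x X (S.frame₂ i x) • cl₂ (ψ.comp i x)
        + II x X (S.frame₃ i x) • cl₃ (ψ.comp i x))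
      - (1 / 2 : ℝ) • Complex.I • (inner ℝ X (S.frame₂ i x) • cl₃ (ψ.comp i x)
        - inner ℝ X (S.frame₃ i x) • cl₂ (ψ.comp i x)) := by
  rw [h.covSpinor_eq nabla hx, hφ i x hx X, map_sub, LinearMap.map_smul_of_tower,
    LinearMap.map_smul_of_tower, spinorOf_clII_mul, tangentVec, spinorOf_adCl_mul, h.comp_eq hx]

/-- Identifies the `ad(X)` term of `∇_X ψ` with `½ X·ψ̄`. -/
theorem clifford_bar (i : ι) (x : M) (X : TangentSpace (𝓡 2) x) (z : Spinor) :
    S.clifford i x X (bar z) = -(Complex.I • (inner ℝ X (S.frame₂ i x) • cl₃ z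
        - inner ℝ X (S.frame₃ i x) • cl₂ z)) := by
  have h := Complex.I_mul_I
  ext k
  fin_cases k <;> simp [clifford, bar, cl₂_apply, cl₃_apply] <;> grind

theorem IsKilling.dirac_eq (hφ : S.IsKilling nabla II φ) (hII : ∀ x X Y, II x X Y = II x Y X)
    (h : CorrespondsToPlus ψ φ) {i : ι} {x : M} (hx : x ∈ S.U i) :
    S.dirac nabla ψ i x = S.meanCurvature II i x • ψ.comp i x - bar (ψ.comp i x) := by
  obtain ⟨h2, h3, h23⟩ := S.orthonormal i x hx
  have h32 : inner ℝ (S.frame₃ i x) (S.frame₂ i x) = 0 := by rw [real_inner_comm, h23]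
  have h22 : inner ℝ (S.frame₂ i x) (S.frame₂ i x) = 1 := by
    rw [real_inner_self_eq_norm_sq, h2, one_pow]
  have h33 : inner ℝ (S.frame₃ i x) (S.frame₃ i x) = 1 := by
    rw [real_inner_self_eq_norm_sq, h3, one_pow]
  -- By symmetry of `II`, the `e₂·e₃` and `e₃·e₂` terms cancel, leaving the trace.
  rw [dirac, hφ.covSpinor_eq h hx, hφ.covSpinor_eq h hx, hII x (S.frame₃ i x) (S.frame₂ i x),
    clifford, clifford, meanCurvature, h22, h33, h23, h32]
  have hI := Complex.I_mul_I
  ext k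
  fin_cases k <;> simp [bar, cl₂_apply, cl₃_apply] <;> grind

theorem IsKilling.mvfderiv_norm_sq (hφ : S.IsKilling nabla II φ) (h : CorrespondsToPlus ψ φ)
    {i : ι} {x : M} (hx : x ∈ S.U i) (X : TangentSpace (𝓡 2) x) :
    mvfderiv (𝓡 2) (fun y ↦ ‖ψ.comp i y‖ ^ 2) x X
      = (inner ℂ (S.clifford i x X (bar (ψ.comp i x))) (ψ.comp i x)).re := by
  have hcov := hφ.covSpinor_eq h hx X
  -- Solved for the plain derivative: the connection term, like the `II` term, is skew-Hermitian and
  -- drops out of the real part of the product with `ψ`. The factor `2` from differentiating the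
  -- square cancels the `½`.
  rw [covSpinor, ← eq_sub_iff_add_eq] at hcov
  rw [mvfderiv_comp_apply_of_hasFDerivAt (hasStrictFDerivAt_norm_sq (ψ.comp i x)).hasFDerivAt
    (ψ.mdifferentiableAt hx) X, hcov, clifford_bar]
  simp [cl₂_apply, cl₃_apply, PiLp.inner_apply, Complex.inner]
  ring

end SpinStructure

end Surface

end MorelH3

end

theorem mainTheorem4 {M : Type*} [TopologicalSpace M] [ChartedSpace MorelH3.E2 M]
    [IsManifold (𝓡 2) ∞ M]
    [Bundle.RiemannianBundle (fun x : M ↦ TangentSpace (𝓡 2) x)]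
    [IsContMDiffRiemannianBundle (𝓡 2) ∞ MorelH3.E2 (fun x : M ↦ TangentSpace (𝓡 2) x)]
    {ι : Type*} (S : MorelH3.SpinStructure M ι)
    (nabla : CovariantDerivative (𝓡 2) MorelH3.E2 (fun x : M ↦ TangentSpace (𝓡 2) x))
    (hnabla : MorelH3.IsLeviCivita nabla)
    (II : Π x : M, TangentSpace (𝓡 2) x →ₗ[ℝ] TangentSpace (𝓡 2) x →ₗ[ℝ] ℝ)
    (hII : ∀ x X Y, II x X Y = II x Y X)
    (φ : S.SigmaSection) (hunit : MorelH3.SpinStructure.IsUnitSection φ)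
    (hφ : S.IsKilling nabla II φ) :
    (∃ ψ : S.SpinorField, MorelH3.SpinStructure.CorrespondsToPlus ψ φ) ∧
    ∀ ψ : S.SpinorField, MorelH3.SpinStructure.CorrespondsToPlus ψ φ →
      ∀ i, ∀ x ∈ S.U i,
        S.dirac nabla ψ i x
          = S.meanCurvature II i x • ψ.comp i x - MorelH3.bar (ψ.comp i x) ∧
        (∀ X : TangentSpace (𝓡 2) x,
          mvfderiv (𝓡 2) (fun y ↦ ‖ψ.comp i y‖ ^ 2) x X
            = (inner ℂ (S.clifford i x X (MorelH3.bar (ψ.comp i x))) (ψ.comp i x)).re) ∧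
        ψ.comp i x ≠ 0 := by
  exact ⟨⟨_, MorelH3.SpinStructure.correspondsToPlus_plusSpinor hunit⟩, fun ψ hψ i x hx ↦
    ⟨hφ.dirac_eq hII hψ hx, hφ.mvfderiv_norm_sq hψ hx,
      hψ.comp_eq hx ▸ MorelH3.spinorOf_ne_zero (hunit i x hx)⟩⟩
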